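/- Let $\mathcal H$ be a complex Hilbert space and let $T$ be a bounded linear operator on $\mathcal H$. Put $|T|=(T^*T)^{1/2}$ and let $T=U|T|$ be the canonical polar decomposition of $T$, that is, $U$ is the unique partial isometry with $T=U|T|$ and $\ker U=\ker T$. Let $\widetilde T=|T|^{1/2}U|T|^{1/2}$ be the Aluthge transform of $T$, let $T^D=|T|U$ be its Duggal transform, and for $\lambda\in[0,1]$ let $M_\lambda(T)=\lambda T+(1-\lambda)T^D$ be its $\lambda$-mean transform. For a bounded operator $A$ on $\mathcal H$ let $\omega(A)=\sup\{|\langle Ax,x\rangle| : x\in\mathcal H,\ \|x\|=1\}$ be its numerical radius and $r(A)=\sup\{|z| : z\in\sigma(A)\}$ its spectral radius (both suprema are read as $0$ if $\mathcal H=\{0\}$). Then, for every $\lambda\in[0,1]$, $$2\sqrt{\lambda-\lambda^2}\,\omega(\widetilde T)\le \omega\big(M_\lambda(T)\big)\le \lambda\,\omega(T)+(1-\lambda)\,\omega(T^D).$$ In particular, $$2\sqrt{\lambda-\lambda^2}\,r(T)\le \omega\big(M_\lambda(T)\big)\le \omega(T).$$ -/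

import Mathlib

namespace MeanTransform

variable {H : Type*} [NormedAddCommGroup H] [InnerProductSpace ℂ H]

/-- The numerical range `W(T) = {⟨T x, x⟩ : ‖x‖ = 1}`. The scalar product of a complex Hilbert
space is linear in its first argument in the usual notation, but `inner ℂ` is linear in its
second one, so `⟨T x, x⟩` is `inner ℂ x (T x)`. -/
def numericalRange (T : H →L[ℂ] H) : Set ℂ :=
  {z : ℂ | ∃ x : H, ‖x‖ = 1 ∧ inner ℂ x (T x) = z}

/-- The numerical radius `ω(T) = sup {|ξ| : ξ ∈ W(T)}`. -/
noncomputable def numericalRadius (T : H →L[ℂ] H) : ℝ :=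
  sSup ((fun z : ℂ => ‖z‖) '' numericalRange T)

/-- The set of which the numerical radius is the supremum is bounded. -/
theorem bddAbove_numericalRange (T : H →L[ℂ] H) :
    BddAbove ((fun z : ℂ => ‖z‖) '' numericalRange T) := by
  refine ⟨‖T‖, ?_⟩
  rintro _ ⟨_, ⟨x, hx, rfl⟩, rfl⟩
  calc ‖inner ℂ x (T x)‖ ≤ ‖x‖ * ‖T x‖ := norm_inner_le_norm _ _
    _ ≤ ‖x‖ * (‖T‖ * ‖x‖) := by gcongr; exact T.le_opNorm x
    _ = ‖T‖ := by rw [hx]; ring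

/-- The spectral radius `r(T) = sup {|z| : z ∈ σ(T)}` as a real number. -/
noncomputable def specRadius (T : H →L[ℂ] H) : ℝ :=
  (spectralRadius ℂ T).toReal

variable [CompleteSpace H]

/-- The spectral radius is finite, so that `specRadius` loses nothing. -/
theorem spectralRadius_ne_top (T : H →L[ℂ] H) : spectralRadius ℂ T ≠ ⊤ := by
  rcases subsingleton_or_nontrivial H with h | h
  · have : Subsingleton (H →L[ℂ] H) := ⟨fun A B => by ext x; exact Subsingleton.elim _ _⟩
    rw [spectrum.SpectralRadius.of_subsingleton]
    simp
  · exact ne_top_of_le_ne_top ENNReal.coe_ne_top (spectrum.spectralRadius_le_nnnorm T)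

/-- `T = U |T|` is the canonical polar decomposition of `T`: the operator `U` is a partial
isometry with `ker U = ker T`; here `|T| = (T* T)^{1/2}` is `CFC.abs T`. -/
structure IsCanonicalPolar (T U : H →L[ℂ] H) : Prop where
  partialIsometry : U * star U * U = U
  ker_iff : ∀ x : H, U x = 0 ↔ T x = 0
  eq_mul_abs : T = U * CFC.abs T

theorem inner_abs_abs (T : H →L[ℂ] H) (x y : H) :
    inner ℂ (CFC.abs T x) (CFC.abs T y) = inner ℂ (T x) (T y) := by
  have hs : star (CFC.abs T) = CFC.abs T := (CFC.abs_nonneg T).isSelfAdjoint.star_eq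
  have h1 : inner ℂ (CFC.abs T x) (CFC.abs T y) = inner ℂ x ((CFC.abs T * CFC.abs T) y) := by
    rw [← ContinuousLinearMap.adjoint_inner_right, ← ContinuousLinearMap.star_eq_adjoint, hs]
    rfl
  rw [h1, CFC.abs_mul_abs, ← ContinuousLinearMap.adjoint_inner_right,
    ← ContinuousLinearMap.star_eq_adjoint]
  rfl

theorem norm_abs_apply (T : H →L[ℂ] H) (x : H) : ‖CFC.abs T x‖ = ‖T x‖ := by
  rw [@norm_eq_sqrt_re_inner ℂ, @norm_eq_sqrt_re_inner ℂ _ _ _ _ (T x), inner_abs_abs]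

theorem abs_apply_eq_zero_of_orthogonal (T : H →L[ℂ] H) (y : H)
    (hy : ∀ x, inner ℂ (CFC.abs T x) y = 0) : T y = 0 := by
  have hs : star (CFC.abs T) = CFC.abs T := (CFC.abs_nonneg T).isSelfAdjoint.star_eq
  have h := hy (CFC.abs T y)
  rw [← ContinuousLinearMap.adjoint_inner_right, ← ContinuousLinearMap.star_eq_adjoint, hs,
    inner_self_eq_zero] at h
  rw [← norm_eq_zero, ← norm_abs_apply, h, norm_zero]

theorem exists_isCanonicalPolar (T : H →L[ℂ] H) : ∃ U, IsCanonicalPolar T U := by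
  let A : H →L[ℂ] H := CFC.abs T
  have hAs : star A = A := (CFC.abs_nonneg T).isSelfAdjoint.star_eq
  let K : Submodule ℂ H := (LinearMap.range A.toLinearMap).topologicalClosure
  have hAK : ∀ x, A x ∈ K := fun x => Submodule.le_topologicalClosure _ ⟨x, rfl⟩
  have : CompleteSpace K := (Submodule.isClosed_topologicalClosure _).completeSpace_coe
  let e : H →ₗ[ℂ] K := A.toLinearMap.codRestrict K hAK
  have he : DenseRange e := by
    intro k
    have hk : (k : H) ∈ closure (Set.range A) := k.2
    rw [closure_subtype, ← Set.range_comp]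
    exact hk
  have hn : ∀ x, ‖T.toLinearMap x‖ ≤ 1 * ‖e x‖ := fun x => by
    rw [one_mul]; exact (norm_abs_apply T x).ge
  let V : K →L[ℂ] H := T.toLinearMap.extendOfNorm e
  have hV : ∀ x, V (e x) = T x := LinearMap.extendOfNorm_eq he ⟨1, hn⟩
  have hVn : ∀ k, ‖V k‖ = ‖k‖ := fun k => by
    refine he.induction_on (p := fun k => ‖V k‖ = ‖k‖) k
      (isClosed_eq (by fun_prop) (by fun_prop)) fun x => ?_
    rw [hV]; exact (norm_abs_apply T x).symm
  let U : H →L[ℂ] H := V ∘L K.orthogonalProjectionOnto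
  have hU : ∀ x, U (A x) = T x := fun x => by
    have : K.orthogonalProjectionOnto (A x) = e x :=
      Submodule.orthogonalProjectionOnto_mem_subspace_eq_self (e x)
    change V (K.orthogonalProjectionOnto (A x)) = T x
    rw [this, hV]
  have hVi : ∀ (x : H) (k : K), inner ℂ (T x) (V k) = inner ℂ (A x) (k : H) := fun x k => by
    refine he.induction_on (p := fun k => inner ℂ (T x) (V k) = inner ℂ (A x) (k : H)) k
      (isClosed_eq (by fun_prop) (by fun_prop)) fun y => ?_
    rw [hV]; exact (inner_abs_abs T x y).symm
  have hUi : ∀ x y, inner ℂ (T x) (U y) = inner ℂ (A x) y := fun x y => by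
    change inner ℂ (T x) (V (K.orthogonalProjectionOnto y)) = _
    rw [hVi]
    exact K.inner_orthogonalProjectionOnto_eq_of_mem_left ⟨A x, hAK x⟩ y
  have hUs : ∀ x, star U (T x) = A x := fun x => by
    refine ext_inner_right ℂ fun y => ?_
    rw [ContinuousLinearMap.star_eq_adjoint, ContinuousLinearMap.adjoint_inner_left, hUi]
  have hVV : ∀ k, U (star U (V k)) = V k := fun k => by
    refine he.induction_on (p := fun k => U (star U (V k)) = V k) k
      (isClosed_eq (by fun_prop) (by fun_prop)) fun x => ?_
    rw [hV, hUs, hU]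
  refine ⟨U, ?_, fun x => ⟨fun h => ?_, fun h => ?_⟩, ?_⟩
  · ext x
    exact hVV _
  · refine abs_apply_eq_zero_of_orthogonal T x fun y => ?_
    have := hUi y x
    rw [h, inner_zero_right] at this
    exact this.symm
  · have h0 : A x = 0 := by rw [← norm_eq_zero, norm_abs_apply, h, norm_zero]
    have h1 : ∀ k : K, inner ℂ (k : H) x = 0 := fun k => by
      refine he.induction_on (p := fun k : K => inner ℂ (k : H) x = 0) k
        (isClosed_eq (by fun_prop) (by fun_prop)) fun y => ?_
      change inner ℂ (A y) x = 0
      rw [← ContinuousLinearMap.adjoint_inner_right, ← ContinuousLinearMap.star_eq_adjoint, hAs,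
        h0, inner_zero_right]
    have h2 : K.orthogonalProjectionOnto x = 0 :=
      Submodule.orthogonalProjectionOnto_apply_of_mem_orthogonal
        ((Submodule.mem_orthogonal _ _).2 fun k hk => h1 ⟨k, hk⟩)
    change V (K.orthogonalProjectionOnto x) = 0
    rw [h2, map_zero]
  · ext x
    exact (hU x).symm

theorem IsCanonicalPolar.unique {T U V : H →L[ℂ] H} (hU : IsCanonicalPolar T U)
    (hV : IsCanonicalPolar T V) : U = V := by
  let K : Submodule ℂ H := (LinearMap.range (CFC.abs T).toLinearMap).topologicalClosure
  have : CompleteSpace K := (Submodule.isClosed_topologicalClosure _).completeSpace_coe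
  have hK : ∀ k ∈ K, U k = V k := fun k hk => by
    have hc : IsClosed {k : H | U k = V k} := isClosed_eq (by fun_prop) (by fun_prop)
    refine closure_minimal (t := {k : H | U k = V k}) ?_ hc hk
    rintro _ ⟨x, rfl⟩
    have h1 := DFunLike.congr_fun hU.eq_mul_abs x
    have h2 := DFunLike.congr_fun hV.eq_mul_abs x
    exact h1.symm.trans h2
  ext x
  obtain ⟨k, hk, z, hz, rfl⟩ := K.exists_add_mem_mem_orthogonal x
  have hT : T z = 0 := abs_apply_eq_zero_of_orthogonal T z fun y =>
    (Submodule.mem_orthogonal _ _).1 hz _ (Submodule.le_topologicalClosure _ ⟨y, rfl⟩)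
  rw [map_add, map_add, hK k hk, (hU.ker_iff z).2 hT, (hV.ker_iff z).2 hT]

/-- The partial isometry `U` of the canonical polar decomposition `T = U |T|`. -/
noncomputable def polarFactor (T : H →L[ℂ] H) : H →L[ℂ] H :=
  Classical.choose (exists_isCanonicalPolar T)

theorem polarFactor_spec (T : H →L[ℂ] H) : IsCanonicalPolar T (polarFactor T) :=
  Classical.choose_spec (exists_isCanonicalPolar T)

/-- The Aluthge transform `|T|^{1/2} U |T|^{1/2}`. -/
noncomputable def aluthge (T : H →L[ℂ] H) : H →L[ℂ] H :=
  CFC.sqrt (CFC.abs T) * polarFactor T * CFC.sqrt (CFC.abs T)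

/-- The Duggal transform `T^D = |T| U`. -/
noncomputable def duggal (T : H →L[ℂ] H) : H →L[ℂ] H :=
  CFC.abs T * polarFactor T

/-- The `lam`-mean transform `lam T + (1 - lam) T^D`. -/
noncomputable def meanTransform (lam : ℝ) (T : H →L[ℂ] H) : H →L[ℂ] H :=
  (lam : ℂ) • T + ((1 - lam : ℝ) : ℂ) • duggal T

end MeanTransform

/-!
# Numerical radius of the mean transform

Write `T = U P` with `P = |T|`, so that `T^D = P U` and the mean transform is
`λ U P + (1 - λ) P U`. The lower bound does not use that `U` is the polar factor: for every
bounded `X` and every `P = S²` with `S ≥ 0`,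
`2 √(λ - λ²) ω(S X S) ≤ ω(λ X P + (1 - λ) P X)` (`sqrt_mul_numericalRadius_le`).

For this, let `P = exp B` with `B` self-adjoint (reached by perturbing `S` to `S + ε`), fix `x`,
and consider the entire function
`h z = λ^(1 - z) (1 - λ)^z ⟨x, exp (z B) X exp ((1 - z) B) x⟩`. Its value at `1 / 2` has modulus
`√(λ - λ²) |⟨x, S X S x⟩|`. On the imaginary axis, `h (i t) + h (1 + i t)` is a unimodular multiple
of `⟨y, (λ X P + (1 - λ) P X) y⟩` with `y = exp (-i t B) x`, a vector of norm `‖x‖`; so the sum of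
the two boundary values of `h` at equal height is at most the numerical radius times `‖x‖²`.
A maximum principle for such sums (`norm_le_of_norm_add_le`) bounds `2 |h (1 / 2)|` by the same
number.

The upper bounds are the triangle inequality and `ω(T^D) ≤ ω(T)`, which holds because
`T^D = U* T U` with `‖U‖ ≤ 1`. Finally `r(T) = r(U S S) = r(S U S)`, and the spectral radius
is at most the numerical radius.
-/

open Complex ComplexConjugate

/-! ### A maximum principle on the strip `0 ≤ re z ≤ 1` -/

/-- A bound for the sums of the boundary values of `h` at equal heights controls the value at the
midpoint of the strip. After rotating `h` so that `h (1 / 2) ≥ 0`, the symmetrization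
`g z = h z + conj (h (1 - conj z))` is holomorphic, its real part on both boundary lines is the
real part of such a sum, and Phragmén–Lindelöf applies to `exp ∘ g`. -/
theorem norm_le_of_norm_add_le {h : ℂ → ℂ} (hd : Differentiable ℂ h) {K M : ℝ}
    (hK : ∀ z : ℂ, 0 ≤ z.re → z.re ≤ 1 → ‖h z‖ ≤ K)
    (hM : ∀ t : ℝ, ‖h (t * I) + h (1 + t * I)‖ ≤ M) : 2 * ‖h (1 / 2)‖ ≤ M := by
  obtain ⟨c, hc, hch⟩ : ∃ c : ℂ, ‖c‖ = 1 ∧ c * h (1 / 2) = ‖h (1 / 2)‖ := by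
    by_cases h0 : h (1 / 2) = 0
    · exact ⟨1, by simp, by rw [h0]; simp⟩
    · exact ⟨‖h (1 / 2)‖ / h (1 / 2), by
        rw [norm_div, norm_real, norm_norm, div_self (norm_ne_zero_iff.2 h0)], by field_simp⟩
  set g : ℂ → ℂ := fun z => c * h z + conj (c * h (1 - conj z)) with hg
  have hgd : Differentiable ℂ g := by
    refine (hd.const_mul c).add fun z => ?_
    have h1 : DifferentiableAt ℂ (fun z => c * h (1 - z)) (conj z) := by fun_prop
    have h2 := h1.conj_conj
    rw [conj_conj] at h2
    exact h2
  have hline : ∀ t : ℝ, (c * (h (t * I) + h (1 + t * I))).re ≤ M := fun t =>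
    (re_le_norm _).trans (by rw [norm_mul, hc, one_mul]; exact hM t)
  have hre : ∀ z, (g z).re = (c * (h z + h (1 - conj z))).re := fun z => by
    simp only [hg, add_re, conj_re, mul_add]
  have key : ‖exp (g (1 / 2))‖ ≤ Real.exp M := by
    refine PhragmenLindelof.vertical_strip (a := 0) (b := 1) (f := fun z => exp (g z))
      hgd.cexp.diffContOnCl ⟨0, by simp [Real.pi_pos], 0, ?_⟩ (fun z hz => ?_) (fun z hz => ?_)
      (by norm_num) (by norm_num)
    · refine Asymptotics.IsBigO.of_bound (Real.exp (K + K)) ?_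
      filter_upwards [Filter.mem_inf_of_right (Filter.mem_principal_self _)] with z hz
      rw [norm_exp]
      simp only [zero_mul, Real.exp_zero, norm_one, mul_one]
      refine Real.exp_le_exp.2 ?_
      rw [hre]
      refine (re_le_norm _).trans ?_
      rw [norm_mul, hc, one_mul]
      refine (norm_add_le _ _).trans (add_le_add (hK z hz.1.le hz.2.le) (hK _ ?_ ?_))
      · simpa using hz.2.le
      · simpa using hz.1.le
    · rw [norm_exp, hre]
      refine Real.exp_le_exp.2 ?_
      have e1 : z = z.im * I := by apply Complex.ext <;> simp [hz]
      have e2 : 1 - conj z = 1 + z.im * I := by apply Complex.ext <;> simp [hz]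
      rw [e2]; nth_rw 1 [e1]; exact hline _
    · rw [norm_exp, hre]
      refine Real.exp_le_exp.2 ?_
      have e1 : z = 1 + z.im * I := by apply Complex.ext <;> simp [hz]
      have e2 : 1 - conj z = z.im * I := by apply Complex.ext <;> simp [hz]
      rw [e2]; nth_rw 1 [e1]; rw [add_comm (h _)]; exact hline _
  rw [norm_exp, hre, Real.exp_le_exp] at key
  have e : (1 : ℂ) - conj (1 / 2) = 1 / 2 := by
    rw [map_div₀, map_one, Complex.conj_ofNat]; norm_num
  rw [e, mul_add, hch, ← two_mul] at key
  simpa using key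

/-! ### Numerical radius and spectral radius -/

namespace MeanTransform

variable {H : Type*} [NormedAddCommGroup H] [InnerProductSpace ℂ H]

theorem numericalRadius_nonneg (T : H →L[ℂ] H) : 0 ≤ numericalRadius T :=
  Real.sSup_nonneg (by rintro _ ⟨z, -, rfl⟩; exact norm_nonneg z)

theorem norm_inner_le_numericalRadius (T : H →L[ℂ] H) (x : H) :
    ‖inner ℂ x (T x)‖ ≤ numericalRadius T * ‖x‖ ^ 2 := by
  by_cases hx : x = 0
  · simp [hx]
  have h1 : ‖inner ℂ ((‖x‖⁻¹ : ℂ) • x) (T ((‖x‖⁻¹ : ℂ) • x))‖ ≤ numericalRadius T :=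
    le_csSup (bddAbove_numericalRange T)
      ⟨_, ⟨_, by rw [norm_smul]; simp [hx], rfl⟩, rfl⟩
  rw [map_smul, inner_smul_left, inner_smul_right, norm_mul, norm_mul] at h1
  simp only [map_inv₀, conj_ofReal, norm_inv, norm_real, norm_norm] at h1
  have h2 : 0 < ‖x‖ := norm_pos_iff.2 hx
  calc ‖inner ℂ x (T x)‖ = (‖x‖⁻¹ * (‖x‖⁻¹ * ‖inner ℂ x (T x)‖)) * ‖x‖ ^ 2 := by field_simp
    _ ≤ _ := by gcongr

theorem numericalRadius_le {T : H →L[ℂ] H} {w : ℝ} (hw : 0 ≤ w)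
    (h : ∀ x : H, ‖x‖ = 1 → ‖inner ℂ x (T x)‖ ≤ w) : numericalRadius T ≤ w :=
  Real.sSup_le (by rintro _ ⟨_, ⟨x, hx, rfl⟩, rfl⟩; exact h x hx) hw

theorem numericalRadius_add_le (A B : H →L[ℂ] H) :
    numericalRadius (A + B) ≤ numericalRadius A + numericalRadius B := by
  refine numericalRadius_le (add_nonneg (numericalRadius_nonneg _) (numericalRadius_nonneg _))
    fun x hx => ?_
  rw [_root_.add_apply, inner_add_right]
  refine (norm_add_le _ _).trans (add_le_add ?_ ?_)
  · simpa [hx] using norm_inner_le_numericalRadius A x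
  · simpa [hx] using norm_inner_le_numericalRadius B x

theorem numericalRadius_smul_le (c : ℂ) (A : H →L[ℂ] H) :
    numericalRadius (c • A) ≤ ‖c‖ * numericalRadius A := by
  refine numericalRadius_le (mul_nonneg (norm_nonneg _) (numericalRadius_nonneg _)) fun x hx => ?_
  rw [_root_.smul_apply, inner_smul_right, norm_mul]
  gcongr
  simpa [hx] using norm_inner_le_numericalRadius A x

theorem numericalRadius_le_norm (A : H →L[ℂ] H) : numericalRadius A ≤ ‖A‖ := by
  refine numericalRadius_le (norm_nonneg _) fun x hx => (norm_inner_le_norm _ _).trans ?_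
  simpa [hx] using A.le_opNorm x

theorem specRadius_mul_comm (A B : H →L[ℂ] H) : specRadius (A * B) = specRadius (B * A) := by
  have key : ∀ A B : H →L[ℂ] H, spectralRadius ℂ (A * B) ≤ spectralRadius ℂ (B * A) := by
    refine fun A B => iSup₂_le fun z hz => ?_
    by_cases h0 : z = 0
    · simp [h0]
    · have : z ∈ spectrum ℂ (A * B) \ {0} := ⟨hz, h0⟩
      rw [spectrum.nonzero_mul_comm] at this
      exact le_iSup₂ (f := fun k (_ : k ∈ spectrum ℂ (B * A)) => (‖k‖₊ : ENNReal)) z this.1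
  exact congrArg ENNReal.toReal (le_antisymm (key A B) (key B A))

variable [CompleteSpace H]

/-- If `‖z‖ > ω(T)` then `z - T` is coercive, hence invertible. -/
theorem norm_le_numericalRadius_of_mem_spectrum {T : H →L[ℂ] H} {z : ℂ}
    (hz : z ∈ spectrum ℂ T) : ‖z‖ ≤ numericalRadius T := by
  by_contra! hlt
  refine hz (ContinuousLinearMap.isUnit_of_forall_le_norm_inner_map _
    (c := ⟨‖z‖ - numericalRadius T, (sub_pos.2 hlt).le⟩) (sub_pos.2 hlt) fun x => ?_)
  have h1 := norm_inner_le_numericalRadius T x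
  have h2 : inner ℂ ((algebraMap ℂ (H →L[ℂ] H) z - T) x) x
      = conj (z * (‖x‖ : ℂ) ^ 2 - inner ℂ x (T x)) := by
    rw [← inner_conj_symm, _root_.sub_apply, inner_sub_right,
      Algebra.algebraMap_eq_smul_one, _root_.smul_apply,
      one_apply_eq_self, inner_smul_right, inner_self_eq_norm_sq_to_K]
    rfl
  rw [h2, RCLike.norm_conj]
  refine le_trans ?_ (norm_sub_norm_le _ _)
  rw [norm_mul, norm_pow, norm_real, norm_norm]
  change ‖x‖ ^ 2 * (‖z‖ - numericalRadius T) ≤ _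
  linarith

theorem specRadius_le_numericalRadius (T : H →L[ℂ] H) : specRadius T ≤ numericalRadius T := by
  refine ENNReal.toReal_le_of_le_ofReal (numericalRadius_nonneg T) (iSup₂_le fun z hz => ?_)
  change ‖z‖ₑ ≤ _
  rw [← ofReal_norm]
  exact ENNReal.ofReal_le_ofReal (norm_le_numericalRadius_of_mem_spectrum hz)

/-! ### The weighted inequality for `S X S` -/

theorem exp_add_smul (B : H →L[ℂ] H) (z w : ℂ) :
    NormedSpace.exp ((z + w) • B) = NormedSpace.exp (z • B) * NormedSpace.exp (w • B) := by
  let _ : NormedAlgebra ℚ (H →L[ℂ] H) := NormedAlgebra.restrictScalars ℚ ℂ _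
  rw [add_smul]
  exact NormedSpace.exp_add_of_commute (((Commute.refl B).smul_left z).smul_right w)

theorem star_exp_smul {B : H →L[ℂ] H} (hB : IsSelfAdjoint B) (z : ℂ) :
    star (NormedSpace.exp (z • B)) = NormedSpace.exp (conj z • B) := by
  rw [NormedSpace.star_exp, star_smul, hB.star_eq]; rfl

theorem inner_exp_smul {B : H →L[ℂ] H} (hB : IsSelfAdjoint B) (z : ℂ) (x y : H) :
    inner ℂ x (NormedSpace.exp (z • B) y) = inner ℂ (NormedSpace.exp (conj z • B) x) y := by
  rw [← star_exp_smul hB, ContinuousLinearMap.star_eq_adjoint,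
    ContinuousLinearMap.adjoint_inner_left]

theorem norm_exp_I_smul_apply {B : H →L[ℂ] H} (hB : IsSelfAdjoint B) (t : ℝ) (x : H) :
    ‖NormedSpace.exp ((t * I) • B) x‖ = ‖x‖ := by
  rw [@norm_eq_sqrt_re_inner ℂ, @norm_eq_sqrt_re_inner ℂ _ _ _ _ x, inner_exp_smul hB,
    ← mul_apply_eq_comp, ← exp_add_smul]
  simp [NormedSpace.exp_zero]

theorem exists_norm_exp_smul_le {B : H →L[ℂ] H} (hB : IsSelfAdjoint B) :
    ∃ C : ℝ, 0 ≤ C ∧ ∀ z : ℂ, 0 ≤ z.re → z.re ≤ 1 → ‖NormedSpace.exp (z • B)‖ ≤ C := by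
  have hc : Continuous fun t : ℝ => NormedSpace.exp ((t : ℂ) • B) :=
    (Differentiable.continuous (𝕜 := ℂ)
      fun z => (hasDerivAt_exp_smul_const B z).differentiableAt).comp continuous_ofReal
  obtain ⟨C, hC⟩ := (isCompact_Icc (a := (0 : ℝ)) (b := 1)).exists_bound_of_continuousOn
    hc.continuousOn
  refine ⟨C, (norm_nonneg _).trans (hC 0 (by simp)), fun z h0 h1 => ?_⟩
  refine ContinuousLinearMap.opNorm_le_bound _ ((norm_nonneg _).trans (hC 0 (by simp)))
    fun x => ?_
  rw [← re_add_im z, exp_add_smul, mul_apply_eq_comp, ← norm_exp_I_smul_apply hB z.im x]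
  exact ContinuousLinearMap.le_of_opNorm_le _ (hC _ ⟨h0, h1⟩) _

/-- The weighted inequality for `S = exp (B / 2)`, at a single vector. -/
theorem sqrt_mul_norm_inner_le_of_exp {B : H →L[ℂ] H} (hB : IsSelfAdjoint B) (X : H →L[ℂ] H)
    {lam : ℝ} (h0 : 0 < lam) (h1 : lam < 1) (x : H) :
    2 * Real.sqrt (lam - lam ^ 2) *
        ‖inner ℂ x ((NormedSpace.exp ((1 / 2 : ℂ) • B) * X * NormedSpace.exp ((1 / 2 : ℂ) • B)) x)‖
      ≤ numericalRadius ((lam : ℂ) • (X * NormedSpace.exp B)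
          + ((1 - lam : ℝ) : ℂ) • (NormedSpace.exp B * X)) * ‖x‖ ^ 2 := by
  have h1' : 0 < 1 - lam := sub_pos.2 h1
  set Y := (lam : ℂ) • (X * NormedSpace.exp B) + ((1 - lam : ℝ) : ℂ) • (NormedSpace.exp B * X)
    with hY
  set E : ℂ → H →L[ℂ] H := fun z => NormedSpace.exp (z • B) with hE
  have hEd : Differentiable ℂ E := fun z => (hasDerivAt_exp_smul_const B z).differentiableAt
  have hE1 : E 1 = NormedSpace.exp B := by simp [hE]
  have hadd : ∀ z w, E (z + w) = E z * E w := exp_add_smul B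
  set φ : ℂ → ℂ := fun z => (lam : ℂ) ^ (1 - z) * ((1 - lam : ℝ) : ℂ) ^ z with hφ
  have hlc : (lam : ℂ) ≠ 0 := ofReal_ne_zero.2 h0.ne'
  have hlc' : ((1 - lam : ℝ) : ℂ) ≠ 0 := ofReal_ne_zero.2 h1'.ne'
  have hφn : ∀ z, ‖φ z‖ = lam ^ (1 - z.re) * (1 - lam) ^ z.re := fun z => by
    simp only [hφ, norm_mul, norm_cpow_eq_rpow_re_of_pos h0, norm_cpow_eq_rpow_re_of_pos h1',
      sub_re, one_re]
  have hφd : Differentiable ℂ φ := by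
    intro z
    refine DifferentiableAt.mul ?_ ?_
    · exact DifferentiableAt.const_cpow (by fun_prop) (Or.inl hlc)
    · exact DifferentiableAt.const_cpow (by fun_prop) (Or.inl hlc')
  -- `exp (i t B)` is unitary, so `exp (z B)` is bounded on the strip.
  obtain ⟨C, hC0, hC⟩ := exists_norm_exp_smul_le hB
  have key := norm_le_of_norm_add_le
    (h := fun z => φ z * inner ℂ x ((E z * X * E (1 - z)) x))
    (K := 1 * (‖x‖ * (C * ‖X‖ * C * ‖x‖)))
    (M := numericalRadius Y * ‖x‖ ^ 2) ?_ ?_ ?_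
  · have e1 : (1 : ℂ) - 1 / 2 = 1 / 2 := by norm_num
    have e2 : ‖φ (1 / 2)‖ = Real.sqrt (lam - lam ^ 2) := by
      have e3 : ((1 / 2 : ℂ)).re = 1 / 2 := by norm_num
      rw [hφn, e3, show lam - lam ^ 2 = lam * (1 - lam) by ring, Real.sqrt_mul h0.le,
        Real.sqrt_eq_rpow, Real.sqrt_eq_rpow]
      norm_num
    simp only [norm_mul, e1, e2] at key
    rw [mul_assoc]
    exact key
  · refine hφd.mul ?_
    have hd : Differentiable ℂ fun z => (E z * X * E (1 - z)) x := by
      have h2 : Differentiable ℂ fun z => E (1 - z) := hEd.comp (by fun_prop)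
      exact ((hEd.mul_const X).mul h2).clm_apply (differentiable_const x)
    exact (innerSL ℂ x).differentiable.comp hd
  · intro z hz0 hz1
    rw [norm_mul]
    refine mul_le_mul ?_ ?_ (norm_nonneg _) zero_le_one
    · rw [hφn]
      exact mul_le_one₀ (Real.rpow_le_one h0.le h1.le (by linarith)) (by positivity)
        (Real.rpow_le_one h1'.le (by linarith) hz0)
    · refine (norm_inner_le_norm _ _).trans ?_
      gcongr
      refine ContinuousLinearMap.le_of_opNorm_le _ ?_ _
      have hz : ‖E z‖ ≤ C := hC z hz0 hz1
      have hz' : ‖E (1 - z)‖ ≤ C := hC (1 - z) (by simpa using hz1) (by simpa using hz0)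
      calc ‖E z * X * E (1 - z)‖ ≤ ‖E z‖ * ‖X‖ * ‖E (1 - z)‖ :=
            (norm_mul_le _ _).trans (by gcongr; exact norm_mul_le _ _)
        _ ≤ C * ‖X‖ * C := by gcongr
  · intro t
    -- The phase shared by the two boundary values at height `t`.
    set u : ℂ := (lam : ℂ) ^ (-(t * I)) * ((1 - lam : ℝ) : ℂ) ^ (t * I) with hu
    have hun : ‖u‖ = 1 := by
      rw [hu, norm_mul, norm_cpow_eq_rpow_re_of_pos h0, norm_cpow_eq_rpow_re_of_pos h1']
      simp
    have hφ0 : φ (t * I) = u * lam := by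
      simp only [hφ, hu]
      rw [sub_eq_add_neg, cpow_add _ _ hlc, cpow_one]; ring
    have hφ1 : φ (1 + t * I) = u * ((1 - lam : ℝ) : ℂ) := by
      simp only [hφ, hu]
      rw [cpow_add _ _ hlc', cpow_one, sub_add_cancel_left]; ring
    have hsum : φ (t * I) * inner ℂ x ((E (t * I) * X * E (1 - t * I)) x)
        + φ (1 + t * I) * inner ℂ x ((E (1 + t * I) * X * E (1 - (1 + t * I))) x)
        = u * inner ℂ (E (-(t * I)) x) (Y (E (-(t * I)) x)) := by
      have hin : ∀ y, inner ℂ (E (-(t * I)) x) y = inner ℂ x (E (t * I) y) := fun y => by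
        rw [hE, inner_exp_smul hB]; simp
      rw [hin, hφ0, hφ1, sub_add_cancel_left, sub_eq_add_neg, hadd 1, add_comm (1 : ℂ), hadd _ 1,
        hE1, hY]
      simp only [mul_apply_eq_comp, add_apply, smul_apply, map_add, map_smul, inner_add_right,
        inner_smul_right]
      ring
    have hnx : ‖E (-(t * I)) x‖ = ‖x‖ := by
      have := norm_exp_I_smul_apply hB (-t) x
      rwa [ofReal_neg, neg_mul] at this
    rw [hsum, norm_mul, hun, one_mul, ← hnx]
    exact norm_inner_le_numericalRadius Y _

/-- The weighted inequality for an invertible positive `R`, which is `exp (B / 2)` for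
`B = 2 log R`. -/
theorem sqrt_mul_norm_inner_le_of_isStrictlyPositive {R : H →L[ℂ] H}
    (hR : IsStrictlyPositive R) (X : H →L[ℂ] H) {lam : ℝ} (h0 : 0 < lam) (h1 : lam < 1) (x : H) :
    2 * Real.sqrt (lam - lam ^ 2) * ‖inner ℂ x ((R * X * R) x)‖
      ≤ numericalRadius ((lam : ℂ) • (X * (R * R)) + ((1 - lam : ℝ) : ℂ) • (R * R * X))
        * ‖x‖ ^ 2 := by
  have hA : IsSelfAdjoint (CFC.log R) := IsSelfAdjoint.log
  have hexp : NormedSpace.exp (CFC.log R) = R := CFC.exp_log R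
  have hB : IsSelfAdjoint ((2 : ℂ) • CFC.log R) := by
    rw [IsSelfAdjoint, star_smul, hA.star_eq]; simp
  have e1 : NormedSpace.exp ((2 : ℂ) • CFC.log R) = R * R := by
    rw [← one_add_one_eq_two, exp_add_smul, one_smul, hexp]
  have e2 : NormedSpace.exp ((1 / 2 : ℂ) • (2 : ℂ) • CFC.log R) = R := by
    rw [smul_smul]; norm_num [hexp]
  have := sqrt_mul_norm_inner_le_of_exp hB X h0 h1 x
  rwa [e1, e2] at this

open Filter Topology in
/-- The weighted inequality for an arbitrary positive `S`, as the limit `ε → 0` of the one for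
`S + ε`. -/
theorem sqrt_mul_numericalRadius_le {S : H →L[ℂ] H} (hS : 0 ≤ S) (X : H →L[ℂ] H) {lam : ℝ}
    (hlam : lam ∈ Set.Icc (0 : ℝ) 1) :
    2 * Real.sqrt (lam - lam ^ 2) * numericalRadius (S * X * S)
      ≤ numericalRadius ((lam : ℂ) • (X * (S * S)) + ((1 - lam : ℝ) : ℂ) • (S * S * X)) := by
  -- At `lam = 0` and `lam = 1` the left-hand side is zero.
  rcases hlam.1.eq_or_lt with rfl | h0
  · simpa using numericalRadius_nonneg _
  rcases hlam.2.eq_or_lt with rfl | h1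
  · simpa using numericalRadius_nonneg _
  set Y : (H →L[ℂ] H) → H →L[ℂ] H := fun R =>
    (lam : ℂ) • (X * (R * R)) + ((1 - lam : ℝ) : ℂ) • (R * R * X) with hY
  set R : ℝ → H →L[ℂ] H := fun ε => S + algebraMap ℝ (H →L[ℂ] H) ε with hR
  have hRc : Continuous R := by fun_prop
  have hR0 : R 0 = S := by simp [hR]
  have hpos : 0 < 2 * Real.sqrt (lam - lam ^ 2) := by
    have : 0 < lam - lam ^ 2 := by nlinarith
    positivity
  rw [← le_div_iff₀' hpos]
  refine numericalRadius_le (div_nonneg (numericalRadius_nonneg _) hpos.le) fun x hx => ?_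
  rw [le_div_iff₀' hpos]
  have hl : Tendsto (fun ε => 2 * Real.sqrt (lam - lam ^ 2) * ‖inner ℂ x ((R ε * X * R ε) x)‖)
      (𝓝[>] 0) (𝓝 (2 * Real.sqrt (lam - lam ^ 2) * ‖inner ℂ x ((S * X * S) x)‖)) := by
    have hc : Continuous fun ε =>
        2 * Real.sqrt (lam - lam ^ 2) * ‖inner ℂ x ((R ε * X * R ε) x)‖ := by fun_prop
    have := hc.tendsto 0
    rw [hR0] at this
    exact this.mono_left nhdsWithin_le_nhds
  have hr : Tendsto (fun ε => numericalRadius (Y S) + ‖Y (R ε) - Y S‖)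
      (𝓝[>] 0) (𝓝 (numericalRadius (Y S))) := by
    have hc : Continuous fun ε => numericalRadius (Y S) + ‖Y (R ε) - Y S‖ := by fun_prop
    have := hc.tendsto 0
    rw [hR0, sub_self, norm_zero, add_zero] at this
    exact this.mono_left nhdsWithin_le_nhds
  refine le_of_tendsto_of_tendsto hl hr ?_
  filter_upwards [self_mem_nhdsWithin] with ε hε
  have hRp : IsStrictlyPositive (R ε) :=
    IsStrictlyPositive.nonneg_add hS (isStrictlyPositive_algebraMap hε)
  have h2 := sqrt_mul_norm_inner_le_of_isStrictlyPositive hRp X h0 h1 x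
  rw [hx, one_pow, mul_one] at h2
  refine h2.trans ?_
  calc numericalRadius (Y (R ε)) = numericalRadius (Y S + (Y (R ε) - Y S)) := by
        rw [add_sub_cancel]
    _ ≤ numericalRadius (Y S) + numericalRadius (Y (R ε) - Y S) := numericalRadius_add_le _ _
    _ ≤ _ := by gcongr; exact numericalRadius_le_norm _

/-! ### Duggal and Aluthge transforms -/

theorem sqrt_abs_mul_self (T : H →L[ℂ] H) :
    CFC.sqrt (CFC.abs T) * CFC.sqrt (CFC.abs T) = CFC.abs T :=
  CFC.sqrt_mul_sqrt_self _ (CFC.abs_nonneg T)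

/-- The initial projection `U* U` fixes the range of `|T|`: by self-adjointness this says that `|T|`
vanishes on the range of `1 - U* U`, which lies in `ker U = ker T`. -/
theorem IsCanonicalPolar.star_mul_self_mul_abs {T U : H →L[ℂ] H} (h : IsCanonicalPolar T U) :
    star U * U * CFC.abs T = CFC.abs T := by
  have hs : star (CFC.abs T) = CFC.abs T := (CFC.abs_nonneg T).isSelfAdjoint.star_eq
  have hU : ∀ x, U ((1 - star U * U) x) = 0 := fun x => by
    have := DFunLike.congr_fun h.partialIsometry x
    simpa [sub_eq_zero] using this.symm
  have h0 : CFC.abs T * (1 - star U * U) = 0 := by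
    ext x
    rw [mul_apply_eq_comp, zero_apply, ← norm_eq_zero, norm_abs_apply, (h.ker_iff _).1 (hU x), norm_zero]
  have h1 := congrArg star h0
  simp only [star_mul, star_sub, star_one, star_star, hs, star_zero, sub_mul, one_mul] at h1
  exact (sub_eq_zero.1 h1).symm

theorem IsCanonicalPolar.norm_le_one {T U : H →L[ℂ] H} (h : IsCanonicalPolar T U) :
    ‖U‖ ≤ 1 := by
  have e : star (star U * U) * (star U * U) = star U * U := by
    rw [star_mul, star_star, mul_assoc, ← mul_assoc U, h.partialIsometry]
  have h1 := CStarRing.norm_star_mul_self (x := star U * U)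
  rw [e, CStarRing.norm_star_mul_self] at h1
  by_contra! hlt
  have h2 : 1 < ‖U‖ * ‖U‖ := by nlinarith
  nlinarith

theorem numericalRadius_duggal_le (T : H →L[ℂ] H) :
    numericalRadius (duggal T) ≤ numericalRadius T := by
  have hp := polarFactor_spec T
  set U := polarFactor T with hU
  have hd : duggal T = star U * T * U := by
    rw [duggal, ← hU]
    nth_rw 1 [← hp.star_mul_self_mul_abs]
    rw [mul_assoc (star U), ← hp.eq_mul_abs]
  refine numericalRadius_le (numericalRadius_nonneg _) fun x hx => ?_
  rw [hd, mul_apply_eq_comp, mul_apply_eq_comp, ContinuousLinearMap.star_eq_adjoint,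
    ContinuousLinearMap.adjoint_inner_right]
  refine (norm_inner_le_numericalRadius T (U x)).trans ?_
  refine mul_le_of_le_one_right (numericalRadius_nonneg _) (pow_le_one₀ (norm_nonneg _) ?_)
  simpa [hx] using ContinuousLinearMap.le_of_opNorm_le U hp.norm_le_one x

/-- `T` and its Aluthge transform are products of the same two factors `U |T|^{1/2}` and
`|T|^{1/2}` in opposite orders, so they have the same spectral radius. -/
theorem specRadius_le_numericalRadius_aluthge (T : H →L[ℂ] H) :
    specRadius T ≤ numericalRadius (aluthge T) := by
  have h : specRadius T = specRadius (aluthge T) := by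
    rw [aluthge, mul_assoc, specRadius_mul_comm, mul_assoc, sqrt_abs_mul_self,
      ← (polarFactor_spec T).eq_mul_abs]
  exact h.trans_le (specRadius_le_numericalRadius _)

end MeanTransform

theorem theorem4p1 {H : Type*} [NormedAddCommGroup H] [InnerProductSpace ℂ H] [CompleteSpace H]
    (T : H →L[ℂ] H) (lam : ℝ) (hlam : lam ∈ Set.Icc (0 : ℝ) 1) :
    (2 * Real.sqrt (lam - lam ^ 2) * MeanTransform.numericalRadius (MeanTransform.aluthge T)
        ≤ MeanTransform.numericalRadius (MeanTransform.meanTransform lam T) ∧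
      MeanTransform.numericalRadius (MeanTransform.meanTransform lam T)
        ≤ lam * MeanTransform.numericalRadius T
          + (1 - lam) * MeanTransform.numericalRadius (MeanTransform.duggal T)) ∧
    (2 * Real.sqrt (lam - lam ^ 2) * MeanTransform.specRadius T
        ≤ MeanTransform.numericalRadius (MeanTransform.meanTransform lam T) ∧
      MeanTransform.numericalRadius (MeanTransform.meanTransform lam T)
        ≤ MeanTransform.numericalRadius T) := by
  have h1 : 0 ≤ 1 - lam := sub_nonneg.2 hlam.2
  have lower : 2 * Real.sqrt (lam - lam ^ 2) *
      MeanTransform.numericalRadius (MeanTransform.aluthge T)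
        ≤ MeanTransform.numericalRadius (MeanTransform.meanTransform lam T) := by
    have h := MeanTransform.sqrt_mul_numericalRadius_le (CFC.sqrt_nonneg (CFC.abs T))
      (MeanTransform.polarFactor T) hlam
    rwa [MeanTransform.sqrt_abs_mul_self, ← (MeanTransform.polarFactor_spec T).eq_mul_abs] at h
  have upper : MeanTransform.numericalRadius (MeanTransform.meanTransform lam T)
        ≤ lam * MeanTransform.numericalRadius T
          + (1 - lam) * MeanTransform.numericalRadius (MeanTransform.duggal T) := by
    refine (MeanTransform.numericalRadius_add_le _ _).trans (add_le_add ?_ ?_)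
    · simpa [abs_of_nonneg hlam.1] using MeanTransform.numericalRadius_smul_le (lam : ℂ) T
    · have h := MeanTransform.numericalRadius_smul_le ((1 - lam : ℝ) : ℂ) (MeanTransform.duggal T)
      rwa [Complex.norm_real, Real.norm_of_nonneg h1] at h
  refine ⟨⟨lower, upper⟩, le_trans ?_ lower, upper.trans ?_⟩
  · gcongr
    exact MeanTransform.specRadius_le_numericalRadius_aluthge T
  · have := mul_le_mul_of_nonneg_left (MeanTransform.numericalRadius_duggal_le T) h1
    linarith
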